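/- Let $G$ be a compact topological group acting continuously (that is, the map $G\times X\to X$, $(\alpha,x)\mapsto \alpha x$, is continuous) and transitively on a compact Hausdorff space $X$, and let $\mu$ be the (unique) $G$-invariant regular Borel probability measure on $X$. Write $\varphi_\alpha(x)=\alpha x$, and let $C(X)$ be the space of continuous complex functions on $X$ with the uniform norm. A linear subspace $Y$ of $C(X)$ or of $L^\infty(\mu)$ is called $G$-invariant if $f\circ\varphi_\alpha\in Y$ for all $f\in Y$, $\alpha\in G$; a subspace of $C(X)$ is called $G$-minimal if it is $G$-invariant and its only $G$-invariant linear subspaces are $\{0\}$ and itself. For $x\in X$ let $$H(x)=\{f\in C(X): f=f\circ\varphi_\alpha \text{ for all } \alpha\in G \text{ with } \alpha x=x\}.$$ Let $\mathscr G=\{H_i: i\in I\}$ be a $G$-collection, i.e. a family of linear subspaces of $C(X)$ such that 1. each $H_i$ is closed in $C(X)$ and $G$-minimal; 2. $\int_X f\,\bar g\,d\mu=0$ whenever $f\in H_i$, $g\in H_j$, $i\neq j$; 3. $L^2(\mu)$ is the (Hilbert space) direct sum of the spaces $H_i$, $i\in I$; 4. $\dim\bigl(H_i\cap H(x)\bigr)=1$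 for every $x\in X$ and every $i\in I$. For $i\in I$ let $\pi_i$ be the orthogonal projection of $L^2(\mu)$ onto $H_i$, and for $\Omega\subset I$ let $E_\Omega$ be the (algebraic) direct sum of the spaces $H_i$ with $i\in\Omega$, i.e. the space of all finite sums of elements of these $H_i$. The weak*-topology on $L^\infty(\mu)$ is the coarsest topology making $f\mapsto\int_X fg\,d\mu$ continuous for every $g\in L^1(\mu)$. **Theorem.** Let $Y$ be a weak*-closed $G$-invariant linear subspace of $L^\infty(\mu)$. Then there is a set $\Omega\subset I$ such that $Y$ is the weak*-closure of $E_\Omega$ in $L^\infty(\mu)$; in fact this holds for $\Omega=\{i\in I:\pi_iY\neq 0\}$, where $\pi_iY$ is the image under $\pi_i$ of $Y\subset L^\infty(\mu)\subset L^2(\mu)$. -/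

import Mathlib

open MeasureTheory
open scoped ENNReal Topology

noncomputable section

namespace GSpace

/-- The translate `f ∘ φ_α` of a continuous function, where `φ_α x = α • x`. -/
def translate {G X : Type*} [Group G] [TopologicalSpace G] [TopologicalSpace X] [MulAction G X]
    [ContinuousSMul G X] (α : G) (f : C(X, ℂ)) : C(X, ℂ) :=
  f.comp ⟨fun x => α • x, continuous_const_smul α⟩

/-- A space of continuous functions is `G`-invariant if it contains `f ∘ φ_α` for each of its
members `f` and each `α` in `G`. -/
def IsInvariant (G : Type*) {X : Type*} [Group G] [TopologicalSpace G] [TopologicalSpace X]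
    [MulAction G X] [ContinuousSMul G X] (Y : Submodule ℂ C(X, ℂ)) : Prop :=
  ∀ α : G, ∀ f ∈ Y, translate α f ∈ Y

/-- A space of continuous functions is `G`-minimal if it is `G`-invariant and contains no
`G`-invariant spaces other than the zero space and itself. -/
def IsMinimal (G : Type*) {X : Type*} [Group G] [TopologicalSpace G] [TopologicalSpace X]
    [MulAction G X] [ContinuousSMul G X] (Y : Submodule ℂ C(X, ℂ)) : Prop :=
  IsInvariant G Y ∧ ∀ Z : Submodule ℂ C(X, ℂ), Z ≤ Y → IsInvariant G Z → Z = ⊥ ∨ Z = Y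

/-- `H(x)`: the continuous functions fixed by every element of `G` that stabilizes `x`. -/
def fixedByStabilizer (G : Type*) {X : Type*} [Group G] [TopologicalSpace G] [TopologicalSpace X]
    [MulAction G X] [ContinuousSMul G X] (x : X) : Submodule ℂ C(X, ℂ) where
  carrier := {f | ∀ α : G, α • x = x → f = translate α f}
  zero_mem' := fun _ _ => rfl
  add_mem' := by
    intro f g hf hg α hα
    ext y
    exact congrArg₂ (· + ·) (DFunLike.congr_fun (hf α hα) y) (DFunLike.congr_fun (hg α hα) y)
  smul_mem' := by
    intro c f hf α hα
    ext y
    exact congrArg (c • ·) (DFunLike.congr_fun (hf α hα) y)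

/-- A space of continuous functions, viewed inside `L²(μ)`. -/
def inL2 {X : Type*} [TopologicalSpace X] [CompactSpace X] [MeasurableSpace X] [BorelSpace X]
    (μ : Measure X) [IsFiniteMeasure μ] (E : Submodule ℂ C(X, ℂ)) : Submodule ℂ (Lp ℂ 2 μ) :=
  E.map (ContinuousMap.toLp 2 μ ℂ).toLinearMap

/-- A space of continuous functions, viewed inside `L^∞(μ)`. -/
def inLinfty {X : Type*} [TopologicalSpace X] [CompactSpace X] [MeasurableSpace X] [BorelSpace X]
    (μ : Measure X) [IsFiniteMeasure μ] (E : Submodule ℂ C(X, ℂ)) : Submodule ℂ (Lp ℂ ∞ μ) :=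
  E.map (ContinuousMap.toLp ∞ μ ℂ).toLinearMap

theorem memLp_two_of_linfty {X : Type*} [MeasurableSpace X] {μ : Measure X} [IsFiniteMeasure μ]
    (f : Lp ℂ ∞ μ) : MemLp f 2 μ :=
  MemLp.mono_exponent (q := ∞) (Lp.memLp f) le_top

/-- The inclusion of `L^∞(μ)` into `L²(μ)`, for a finite measure `μ`. -/
def linftyToL2 {X : Type*} [MeasurableSpace X] (μ : Measure X) [IsFiniteMeasure μ] :
    Lp ℂ ∞ μ →ₗ[ℂ] Lp ℂ 2 μ where
  toFun f := (memLp_two_of_linfty f).toLp f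
  map_add' f g := by
    apply Lp.ext
    filter_upwards [(memLp_two_of_linfty (f + g)).coeFn_toLp, (memLp_two_of_linfty f).coeFn_toLp,
      (memLp_two_of_linfty g).coeFn_toLp, Lp.coeFn_add f g,
      Lp.coeFn_add ((memLp_two_of_linfty f).toLp f) ((memLp_two_of_linfty g).toLp g)]
      with x h1 h2 h3 h4 h5
    rw [h1, h4, h5, Pi.add_apply, Pi.add_apply, h2, h3]
  map_smul' c f := by
    apply Lp.ext
    filter_upwards [(memLp_two_of_linfty (c • f)).coeFn_toLp, (memLp_two_of_linfty f).coeFn_toLp,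
      Lp.coeFn_smul c f, Lp.coeFn_smul c ((memLp_two_of_linfty f).toLp f)] with x h1 h2 h3 h4
    rw [h1, h3, RingHom.id_apply, h4, Pi.smul_apply, Pi.smul_apply, h2]

theorem coeFn_linftyToL2 {X : Type*} [MeasurableSpace X] (μ : Measure X) [IsFiniteMeasure μ]
    (f : Lp ℂ ∞ μ) : linftyToL2 μ f =ᵐ[μ] f :=
  (memLp_two_of_linfty f).coeFn_toLp

/-- The pairing of `f ∈ L^∞(μ)` with `g ∈ L¹(μ)`, namely the integral of `f g`. -/
def pairing {X : Type*} [MeasurableSpace X] (μ : Measure X) :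
    Lp ℂ ∞ μ →ₗ[ℂ] Lp ℂ 1 μ →ₗ[ℂ] ℂ :=
  ((ContinuousLinearMap.mul ℂ ℂ).lpPairing μ ∞ 1).toLinearMap₁₂

theorem pairing_apply {X : Type*} [MeasurableSpace X] (μ : Measure X)
    (f : Lp ℂ ∞ μ) (g : Lp ℂ 1 μ) : pairing μ f g = ∫ x, f x * g x ∂μ :=
  (ContinuousLinearMap.mul ℂ ℂ).lpPairing_eq_integral f g

/-- The weak*-topology of `L^∞(μ)`: the coarsest topology for which `f ↦ ∫ f g dμ` is continuous
for every `g ∈ L¹(μ)`. -/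
abbrev weakStarTopology {X : Type*} [MeasurableSpace X] (μ : Measure X) :
    TopologicalSpace (Lp ℂ ∞ μ) :=
  WeakBilin.instTopologicalSpace (pairing μ)

/-- The weak*-closure of a subset of `L^∞(μ)`. -/
def weakStarClosure {X : Type*} [MeasurableSpace X] (μ : Measure X) (S : Set (Lp ℂ ∞ μ)) :
    Set (Lp ℂ ∞ μ) :=
  closure[weakStarTopology μ] S

/-- A subspace of `L^∞(μ)` is `G`-invariant if it contains (the class of) `f ∘ φ_α` for each of its
members `f` and each `α` in `G`. -/
def IsInvariantLinfty (G : Type*) {X : Type*} [Group G] [MulAction G X] [MeasurableSpace X]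
    [MeasurableConstSMul G X] {μ : Measure X} [SMulInvariantMeasure G X μ]
    (Y : Submodule ℂ (Lp ℂ ∞ μ)) : Prop :=
  ∀ α : G, ∀ f ∈ Y,
    Lp.compMeasurePreserving (fun x => α • x) (measurePreserving_smul α μ) f ∈ Y

/-- The family `H` of spaces of continuous functions is a `G`-collection. -/
structure IsGCollection (G : Type*) {X I : Type*} [Group G] [TopologicalSpace G]
    [TopologicalSpace X] [CompactSpace X] [MulAction G X] [ContinuousSMul G X]
    [MeasurableSpace X] [BorelSpace X] (μ : Measure X) [IsFiniteMeasure μ]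
    (H : I → Submodule ℂ C(X, ℂ)) : Prop where
  isClosed : ∀ i, IsClosed (H i : Set C(X, ℂ))
  isMinimal : ∀ i, IsMinimal G (H i)
  orthogonal : ∀ i j, i ≠ j → ∀ f ∈ H i, ∀ g ∈ H j, ∫ x, f x * starRingEnd ℂ (g x) ∂μ = 0
  isHilbertSum : IsHilbertSum ℂ (fun i => ↥(inL2 μ (H i))) (fun i => (inL2 μ (H i)).subtypeₗᵢ)
  finrank_inf_fixedByStabilizer :
    ∀ (x : X) (i : I), Module.finrank ℂ ↥(H i ⊓ fixedByStabilizer G x) = 1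

/-- Each summand of an internal Hilbert sum admits an orthogonal projection. -/
theorem hasOrthogonalProjection_of_isHilbertSum {I E : Type*} [NormedAddCommGroup E]
    [InnerProductSpace ℂ E] [CompleteSpace E] {F : I → Submodule ℂ E}
    (h : IsHilbertSum ℂ (fun i => ↥(F i)) (fun i => (F i).subtypeₗᵢ)) (i : I) :
    (F i).HasOrthogonalProjection := by
  classical
  refine ⟨fun v => ⟨(h.linearIsometryEquiv v i : E), SetLike.coe_mem _, ?_⟩⟩
  have hs := h.hasSum_linearIsometryEquiv_symm (h.linearIsometryEquiv v)
  rw [LinearIsometryEquiv.symm_apply_apply] at hs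
  rw [Submodule.mem_orthogonal]
  intro u hu
  have h1 := hs.mapL (innerSL ℂ u)
  have h2 : HasSum (fun j => innerSL ℂ u ((F j).subtypeₗᵢ (h.linearIsometryEquiv v j)))
      (innerSL ℂ u ((F i).subtypeₗᵢ (h.linearIsometryEquiv v i))) := by
    refine hasSum_single i fun j hj => ?_
    exact h.OrthogonalFamily (Ne.symm hj) ⟨u, hu⟩ (h.linearIsometryEquiv v j)
  have h3 := h1.unique h2
  rw [inner_sub_right, sub_eq_zero]
  exact h3

/-- `π_i`, the orthogonal projection of `L²(μ)` onto `H_i`. -/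
def IsGCollection.proj {G X I : Type*} [Group G] [TopologicalSpace G]
    [TopologicalSpace X] [CompactSpace X] [MulAction G X] [ContinuousSMul G X]
    [MeasurableSpace X] [BorelSpace X] {μ : Measure X} [IsFiniteMeasure μ]
    {H : I → Submodule ℂ C(X, ℂ)} (hH : IsGCollection G μ H) (i : I) :
    Lp ℂ 2 μ →L[ℂ] ↥(inL2 μ (H i)) :=
  haveI := hasOrthogonalProjection_of_isHilbertSum hH.isHilbertSum i
  (inL2 μ (H i)).orthogonalProjectionOnto

/-- `E_Ω`, the (algebraic) sum of the spaces `H_i` with `i ∈ Ω`. The sum is direct when `H` is a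
`G`-collection, since the `H_i` are then pairwise orthogonal. -/
def sumOver {X I : Type*} [TopologicalSpace X] (H : I → Submodule ℂ C(X, ℂ)) (Ω : Set I) :
    Submodule ℂ C(X, ℂ) :=
  ⨆ i ∈ Ω, H i

end GSpace

end

/-! For u ∈ C(G) the smoothing u * f = ∫ u(α) f∘φ_α dν has uniform norm at most ‖u‖‖f‖₂, because
orbit averages are μ-averages (`norm_conv_le`). It therefore maps L²(μ) into C(X), turns the
L²-expansion of f into a uniformly convergent one with terms u * π_i f ∈ H_i, and maps a
weak*-closed invariant Y into itself (`convL2_mem`).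

If π_i f ≠ 0 for some f ∈ Y, pick x with (π_i f)(x) ≠ 0 and put u(α) = k(α⁻¹x), where k is the
reproducing kernel of H_i at x. This u absorbs stabilizer translations, and by condition 4 the
stabilizer average of an element of H_j is a multiple of the kernel k_j of H_j at x. Since u * k_j =
π_j k, only j = i survives, and u * f is a nonzero multiple of k. So k ∈ Y, and minimality gives H_i
⊂ Y (`IsGCollection.inLinfty_le`).

Conversely, if g ∈ L¹(μ) annihilates E_Ω and f ∈ Y, then ⟨u * f, g⟩ = 0 for all u, so the continuous
function α ↦ ⟨f∘φ_α, g⟩ vanishes; α = 1 gives ⟨f, g⟩ = 0 (`IsGCollection.pairing_eq_zero`).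
Hahn–Banach then puts Y in the weak*-closure of E_Ω. -/

set_option linter.unusedSectionVars false

/-! ### Hahn–Banach separation in weak topologies -/

/-- A point outside a weakly closed subspace is separated from it by a vector of the paired
space. -/
theorem LinearMap.exists_separating_of_isClosed_weakBilin {E F : Type*} [AddCommGroup E]
    [Module ℂ E] [AddCommGroup F] [Module ℂ F] (B : E →ₗ[ℂ] F →ₗ[ℂ] ℂ) (S : Submodule ℂ E)
    (hS : IsClosed[WeakBilin.instTopologicalSpace B] (S : Set E)) {x : E} (hx : x ∉ S) :
    ∃ y, (∀ s ∈ S, B s y = 0) ∧ B x y ≠ 0 := by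
  let S' : Submodule ℂ (WeakBilin B) := S
  have hS' : IsClosed (S' : Set (WeakBilin B)) := hS
  have : LocallyConvexSpace ℝ (WeakBilin B) :=
    B.weakBilin_withSeminorms.toLocallyConvexSpace
  have hconv : Convex ℝ (S' : Set (WeakBilin B)) := (S'.restrictScalars ℝ).convex
  obtain ⟨φ, c, hc, hcx⟩ := RCLike.geometric_hahn_banach_closed_point (𝕜 := ℂ)
    (E := WeakBilin B) (x := x) hconv hS' hx
  obtain ⟨y, hy⟩ := LinearMap.dualEmbedding_surjective B φ
  have hφ : ∀ z : E, φ (z : WeakBilin B) = B z y := fun z => by rw [← hy]; rfl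
  have h0 : 0 < c := by simpa using hc 0 S'.zero_mem
  refine ⟨y, fun s hs => ?_, fun h => ?_⟩
  · by_contra hne
    -- Rescaling `s` brings the value to exactly `c`, against the strict bound.
    have h1 := hc (((c : ℂ) / B s y) • (s : E)) (S'.smul_mem _ hs)
    rw [hφ, map_smul, LinearMap.smul_apply, smul_eq_mul, div_mul_cancel₀ _ hne] at h1
    simp at h1
  · rw [hφ, h] at hcx
    simp only [map_zero] at hcx
    exact lt_asymm h0 hcx

/-- A point outside the weak closure of a subspace is separated from the subspace by a vector of the
paired space. -/
theorem LinearMap.exists_separating_of_notMem_closure_weakBilin {E F : Type*} [AddCommGroup E]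
    [Module ℂ E] [AddCommGroup F] [Module ℂ F] (B : E →ₗ[ℂ] F →ₗ[ℂ] ℂ) (S : Submodule ℂ E) {x : E}
    (hx : x ∉ closure[WeakBilin.instTopologicalSpace B] (S : Set E)) :
    ∃ y, (∀ s ∈ S, B s y = 0) ∧ B x y ≠ 0 := by
  let S' : Submodule ℂ (WeakBilin B) := S
  obtain ⟨y, hy, hxy⟩ := B.exists_separating_of_isClosed_weakBilin S'.topologicalClosure
    S'.isClosed_topologicalClosure hx
  exact ⟨y, fun s hs => hy s (S'.le_topologicalClosure hs), hxy⟩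

/-! ### Haar probability measure of a compact group -/

namespace MeasureTheory.Measure

variable {G : Type*} [Group G] [TopologicalSpace G] [IsTopologicalGroup G] [CompactSpace G]
  [MeasurableSpace G] [BorelSpace G]

theorem exists_isHaarMeasure_isProbabilityMeasure (G : Type*) [Group G] [TopologicalSpace G]
    [IsTopologicalGroup G] [CompactSpace G] [MeasurableSpace G] [BorelSpace G] :
    ∃ ν : Measure G, ν.IsHaarMeasure ∧ IsProbabilityMeasure ν :=
  ⟨haarMeasure ⊤, inferInstance, ⟨haarMeasure_self (K₀ := ⊤)⟩⟩

/-- A right translate of a left Haar probability measure is another one, and there is only one. -/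
theorem isMulRightInvariant_of_compactSpace (ν : Measure G) [ν.IsHaarMeasure]
    [IsProbabilityMeasure ν] : ν.IsMulRightInvariant := by
  refine ⟨fun g => ?_⟩
  have : IsProbabilityMeasure (map (· * g) ν) :=
    isProbabilityMeasure_map (by fun_prop)
  exact isHaarMeasure_eq_of_isProbabilityMeasure _ _

theorem isInvInvariant_of_compactSpace (ν : Measure G) [ν.IsHaarMeasure]
    [IsProbabilityMeasure ν] : ν.IsInvInvariant := by
  have := isMulRightInvariant_of_compactSpace ν
  have : IsProbabilityMeasure ν.inv := isProbabilityMeasure_map (by fun_prop)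
  have : ν.inv.IsHaarMeasure := { }
  exact ⟨isHaarMeasure_eq_of_isProbabilityMeasure _ _⟩

end MeasureTheory.Measure

/-! ### Orbit averages and convolution on C(X) -/

namespace GSpace

section Orbit

variable {G X : Type*} [Group G] [TopologicalSpace G] [IsTopologicalGroup G] [CompactSpace G]
  [TopologicalSpace X] [CompactSpace X] [MulAction G X] [ContinuousSMul G X]
  [MeasurableSpace G] [BorelSpace G]

/-- Averages over orbits agree with averages over the space. -/
theorem integral_orbit {E : Type*} [NormedAddCommGroup E] [NormedSpace ℝ E] [CompleteSpace E]
    [MulAction.IsPretransitive G X] [MeasurableSpace X] [BorelSpace X] (μ : Measure X)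
    [IsProbabilityMeasure μ] [SMulInvariantMeasure G X μ] (ν : Measure G) [ν.IsHaarMeasure]
    [IsProbabilityMeasure ν] (φ : C(X, E)) (x : X) :
    ∫ α : G, φ (α • x) ∂ν = ∫ y, φ y ∂μ := by
  have := Measure.isMulRightInvariant_of_compactSpace ν
  -- By transitivity and right invariance of `ν`, the orbit average does not depend on the base
  -- point.
  have hconst : ∀ y, ∫ α : G, φ (α • y) ∂ν = ∫ α : G, φ (α • x) ∂ν := by
    intro y
    obtain ⟨β, rfl⟩ := MulAction.exists_smul_eq G x y
    simp_rw [smul_smul]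
    exact integral_mul_right_eq_self (fun α => φ (α • x)) β
  calc ∫ α : G, φ (α • x) ∂ν = ∫ y, ∫ α : G, φ (α • y) ∂ν ∂μ := by simp [hconst]
    _ = ∫ α : G, ∫ y, φ (α • y) ∂μ ∂ν :=
        -- No second countability is assumed, so Fubini is used in its form for continuous functions
        -- of compact support.
        integral_integral_swap_of_hasCompactSupport (f := fun (y : X) (α : G) => φ (α • y))
          (φ.continuous.comp (continuous_snd.smul continuous_fst)) (.of_compactSpace _)
    _ = ∫ α : G, ∫ y, φ y ∂μ ∂ν := by
        congr 1 with α
        exact (measurePreserving_smul α μ).integral_comp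
          (Homeomorph.smul α).measurableEmbedding φ
    _ = _ := by simp

omit [IsTopologicalGroup G] [CompactSpace G] [MeasurableSpace G] [BorelSpace G]
  [CompactSpace X] in
theorem continuous_translate (f : C(X, ℂ)) : Continuous fun α : G => translate α f :=
  (ContinuousMap.curry ⟨fun p : G × X => f (p.1 • p.2), by fun_prop⟩).continuous

/-- The convolution `∫ u(α) f ∘ φ_α dν(α)` of a continuous function on the group with a continuous
function on the space. -/
noncomputable def conv (ν : Measure G) (u : C(G, ℂ)) (f : C(X, ℂ)) : C(X, ℂ) :=
  ∫ α : G, u α • translate α f ∂ν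

variable (ν : Measure G) [IsProbabilityMeasure ν]

omit [IsTopologicalGroup G] in
theorem integrable_smul_translate (u : C(G, ℂ)) (f : C(X, ℂ)) :
    Integrable (fun α : G => u α • translate α f) ν :=
  (u.continuous.smul (continuous_translate f)).integrable_of_hasCompactSupport (.of_compactSpace _)

omit [IsTopologicalGroup G] in
theorem conv_apply (u : C(G, ℂ)) (f : C(X, ℂ)) (x : X) :
    conv ν u f x = ∫ α : G, u α * f (α • x) ∂ν := by
  rw [conv, ContinuousMap.integral_apply (integrable_smul_translate ν u f)]
  rfl

omit [IsTopologicalGroup G] in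
-- A closed subspace is closed and convex, so it contains the mean of a function with values in it.
theorem conv_mem (u : C(G, ℂ)) {H : Submodule ℂ C(X, ℂ)} (hcl : IsClosed (H : Set C(X, ℂ)))
    (hinv : IsInvariant G H) {f : C(X, ℂ)} (hf : f ∈ H) : conv ν u f ∈ H :=
  (H.restrictScalars ℝ).convex.integral_mem hcl
    (.of_forall fun α => H.smul_mem _ (hinv α f hf)) (integrable_smul_translate ν u f)

omit [IsTopologicalGroup G] in
theorem clm_conv {E : Type*} [NormedAddCommGroup E] [NormedSpace ℂ E] [CompleteSpace E]
    (L : C(X, ℂ) →L[ℂ] E) (u : C(G, ℂ)) (f : C(X, ℂ)) :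
    L (conv ν u f) = ∫ α : G, u α • L (translate α f) ∂ν := by
  rw [conv, ← L.integral_comp_comm (integrable_smul_translate ν u f)]
  simp

/-- Convolution with a fixed continuous function on the group, as a linear map. -/
noncomputable def convₗ (u : C(G, ℂ)) : C(X, ℂ) →ₗ[ℂ] C(X, ℂ) where
  toFun := conv ν u
  map_add' f g := by
    simp only [conv]
    rw [← integral_add (integrable_smul_translate ν u f) (integrable_smul_translate ν u g)]
    simp_rw [← smul_add]
    rfl
  map_smul' c f := by
    simp only [conv, RingHom.id_apply]
    rw [← integral_smul]
    congr 1 with α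
    exact mul_left_comm _ _ _

variable [MulAction.IsPretransitive G X] [MeasurableSpace X] [BorelSpace X] (μ : Measure X)
    [IsProbabilityMeasure μ] [SMulInvariantMeasure G X μ]

/-- The orbit average of |f| is its L¹ norm, hence at most its L² norm. Bounding a uniform norm by
an L² norm is what lets convolution extend to L²(μ) with continuous values. -/
theorem norm_conv_le [ν.IsHaarMeasure] (u : C(G, ℂ)) (f : C(X, ℂ)) :
    ‖conv ν u f‖ ≤ ‖u‖ * ‖ContinuousMap.toLp 2 μ ℂ f‖ := by
  have hn : ∫ y, ‖f y‖ ∂μ ≤ ‖ContinuousMap.toLp 2 μ ℂ f‖ := by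
    have hm : MemLp f 2 μ := f.memLp μ ℂ
    rw [Lp.norm_def, eLpNorm_congr_ae (f.coeFn_toLp (𝕜 := ℂ) μ),
      integral_norm_eq_lintegral_enorm hm.1, ← eLpNorm_one_eq_lintegral_enorm]
    exact ENNReal.toReal_mono hm.2.ne (eLpNorm_le_eLpNorm_of_exponent_le one_le_two hm.1)
  refine (ContinuousMap.norm_le _ (by positivity)).2 fun x => ?_
  rw [conv_apply]
  calc ‖∫ α : G, u α * f (α • x) ∂ν‖ ≤ ∫ α : G, ‖u‖ * ‖f (α • x)‖ ∂ν := by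
        refine norm_integral_le_of_norm_le ?_ (.of_forall fun α => ?_)
        · exact Continuous.integrable_of_hasCompactSupport (by fun_prop) (.of_compactSpace _)
        · rw [norm_mul]
          gcongr
          exact u.norm_coe_le_norm α
    _ = ‖u‖ * ∫ y, ‖f y‖ ∂μ := by
        rw [integral_const_mul]
        congr 1
        exact integral_orbit μ ν ⟨fun y => ‖f y‖, by fun_prop⟩ x
    _ ≤ _ := by gcongr

end Orbit
end GSpace

/-! ### Convolution on L²(μ) and its duality with L¹(μ) -/

namespace GSpace

section Convolution

variable {G X : Type*} [Group G] [TopologicalSpace G] [IsTopologicalGroup G] [CompactSpace G]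
  [TopologicalSpace X] [CompactSpace X] [T2Space X] [MulAction G X] [ContinuousSMul G X]
  [MulAction.IsPretransitive G X] [MeasurableSpace G] [BorelSpace G]
  [MeasurableSpace X] [BorelSpace X] (ν : Measure G) [IsProbabilityMeasure ν] [ν.IsHaarMeasure]
  (μ : Measure X) [IsProbabilityMeasure μ] [μ.Regular] [SMulInvariantMeasure G X μ]

/-- Convolution with a fixed continuous function on the group, extended to `L²(μ)`; its values are
continuous functions. -/
noncomputable def convL2 (u : C(G, ℂ)) : Lp ℂ 2 μ →L[ℂ] C(X, ℂ) :=
  (convₗ ν u).extendOfNorm (ContinuousMap.toLp 2 μ ℂ : C(X, ℂ) →L[ℂ] Lp ℂ 2 μ).toLinearMap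

theorem convL2_toLp (u : C(G, ℂ)) (f : C(X, ℂ)) :
    convL2 ν μ u (ContinuousMap.toLp 2 μ ℂ f) = conv ν u f := by
  have hd : DenseRange (ContinuousMap.toLp 2 μ ℂ : C(X, ℂ) →L[ℂ] Lp ℂ 2 μ).toLinearMap :=
    ContinuousMap.toLp_denseRange ℂ μ ℂ (by simp)
  have hn : ∃ C, ∀ f, ‖convₗ ν u f‖ ≤
      C * ‖(ContinuousMap.toLp 2 μ ℂ : C(X, ℂ) →L[ℂ] Lp ℂ 2 μ).toLinearMap f‖ :=
    ⟨‖u‖, norm_conv_le ν μ u⟩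
  exact LinearMap.extendOfNorm_eq hd hn f

/-- The translate `f ∘ φ_α` of a class of functions. -/
noncomputable abbrev translateLp (p : ℝ≥0∞) (α : G) : Lp ℂ p μ →+ Lp ℂ p μ :=
  Lp.compMeasurePreserving (fun x => α • x) (measurePreserving_smul α μ)

theorem translateLp_toLp (p : ℝ≥0∞) [Fact (1 ≤ p)] (α : G) (f : C(X, ℂ)) :
    translateLp μ p α (ContinuousMap.toLp p μ ℂ f) = ContinuousMap.toLp p μ ℂ (translate α f) := by
  apply Lp.ext
  filter_upwards [Lp.coeFn_compMeasurePreserving (ContinuousMap.toLp p μ ℂ f)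
      (measurePreserving_smul α μ), (translate α f).coeFn_toLp (p := p) (𝕜 := ℂ) μ,
    (measurePreserving_smul α μ).quasiMeasurePreserving.ae
      (f.coeFn_toLp (p := p) (𝕜 := ℂ) μ)] with x h1 h2 h3
  rw [h1, h2, Function.comp_apply, h3]
  rfl

/-- Invariance of `μ` moves the translation to the L¹ side, where it is norm continuous in `α`; on
L^∞ it need not be. -/
theorem pairing_translateLp (f : Lp ℂ ∞ μ) (g : Lp ℂ 1 μ) (α : G) :
    pairing μ (translateLp μ ∞ α f) g = pairing μ f (translateLp μ 1 α⁻¹ g) := by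
  rw [pairing_apply, pairing_apply,
    ← (measurePreserving_smul α μ).integral_comp (Homeomorph.smul α).measurableEmbedding
      fun x => f x * translateLp μ 1 α⁻¹ g x]
  refine integral_congr_ae ?_
  filter_upwards [Lp.coeFn_compMeasurePreserving f (measurePreserving_smul α μ),
    (measurePreserving_smul α μ).quasiMeasurePreserving.ae
      (Lp.coeFn_compMeasurePreserving g (measurePreserving_smul α⁻¹ μ))] with x h1 h2
  rw [h1, h2]
  simp

theorem continuous_translateLp_one (g : Lp ℂ 1 μ) :
    Continuous fun α : G => translateLp μ 1 α⁻¹ g :=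
  continuous_const.compMeasurePreservingLp
    (g := ContinuousMap.curry ⟨fun p : G × X => p.1⁻¹ • p.2, by fun_prop⟩)
    (map_continuous _) (fun α => measurePreserving_smul α⁻¹ μ) (by simp)

/-- The pairing of `L^∞(μ)` with `L¹(μ)`, as a continuous bilinear map. -/
noncomputable abbrev pairingL : Lp ℂ ∞ μ →L[ℂ] Lp ℂ 1 μ →L[ℂ] ℂ :=
  (ContinuousLinearMap.mul ℂ ℂ).lpPairing μ ∞ 1

theorem continuous_pairing_translateLp (f : Lp ℂ ∞ μ) (g : Lp ℂ 1 μ) :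
    Continuous fun α : G => pairing μ (translateLp μ ∞ α f) g := by
  simp_rw [pairing_translateLp]
  exact (pairingL μ f).continuous.comp (continuous_translateLp_one μ g)

/-- The functional `g ↦ ∫ u(α) ⟨f ∘ φ_α, g⟩ dν(α)` on `L¹(μ)`. -/
noncomputable def convDual (u : C(G, ℂ)) (f : Lp ℂ ∞ μ) : Lp ℂ 1 μ →L[ℂ] ℂ :=
  have hi (g : Lp ℂ 1 μ) : Integrable (fun α : G => u α * pairing μ (translateLp μ ∞ α f) g) ν :=
    (u.continuous.mul (continuous_pairing_translateLp μ f g)).integrable_of_hasCompactSupport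
      (.of_compactSpace _)
  LinearMap.mkContinuous
    { toFun := fun g => ∫ α : G, u α * pairing μ (translateLp μ ∞ α f) g ∂ν
      map_add' := fun g g' => by
        rw [← integral_add (hi g) (hi g')]
        simp_rw [map_add, mul_add]
      map_smul' := fun c g => by
        simp_rw [map_smul, smul_eq_mul, mul_left_comm _ c]
        exact integral_const_mul _ _ }
    (‖u‖ * ‖pairingL μ f‖) fun g => by
      refine (norm_integral_le_of_norm_le_const (C := ‖u‖ * ‖pairingL μ f‖ * ‖g‖)
        (.of_forall fun α => ?_)).trans (by simp)
      rw [norm_mul, mul_assoc, pairing_translateLp]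
      gcongr
      · exact u.norm_coe_le_norm α
      · refine ((pairingL μ f).le_opNorm _).trans ?_
        rw [Lp.norm_compMeasurePreserving]

theorem convDual_apply (u : C(G, ℂ)) (f : Lp ℂ ∞ μ) (g : Lp ℂ 1 μ) :
    convDual ν μ u f g = ∫ α : G, u α * pairing μ (translateLp μ ∞ α f) g ∂ν := rfl

/-- The transpose of convolution, on continuous functions. -/
noncomputable def convT (u : C(G, ℂ)) (g : C(X, ℂ)) : C(X, ℂ) :=
  ∫ α : G, u α • translate α⁻¹ g ∂ν

theorem clm_convT (L : C(X, ℂ) →L[ℂ] ℂ) (u : C(G, ℂ)) (g : C(X, ℂ)) :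
    L (convT ν u g) = ∫ α : G, u α * L (translate α⁻¹ g) ∂ν := by
  rw [convT, ← L.integral_comp_comm]
  · simp
  · exact (u.continuous.smul ((continuous_translate g).comp
      continuous_inv)).integrable_of_hasCompactSupport (.of_compactSpace _)

theorem convDual_toLp (u : C(G, ℂ)) (f : Lp ℂ ∞ μ) (g : C(X, ℂ)) :
    convDual ν μ u f (ContinuousMap.toLp 1 μ ℂ g) = ∫ x, f x * convT ν u g x ∂μ := by
  have h := clm_convT ν ((pairingL μ f).comp (ContinuousMap.toLp 1 μ ℂ)) u g
  rw [convDual_apply]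
  simp_rw [pairing_translateLp, translateLp_toLp]
  refine h.symm.trans ((pairing_apply μ f _).trans (integral_congr_ae ?_))
  filter_upwards [(convT ν u g).coeFn_toLp (p := 1) (𝕜 := ℂ) μ] with x h1
  exact congrArg (f x * ·) h1

/-- The pairing of `L²(μ)` with itself without complex conjugation, against a continuous
function. -/
noncomputable def integralMul (g : C(X, ℂ)) : Lp ℂ 2 μ →L[ℂ] ℂ :=
  innerSL ℂ (ContinuousMap.toLp 2 μ ℂ (star g))

theorem integralMul_apply (g : C(X, ℂ)) (f : Lp ℂ 2 μ) :
    integralMul μ g f = ∫ x, f x * g x ∂μ := by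
  rw [integralMul, innerSL_apply_apply, L2.inner_def]
  refine integral_congr_ae ?_
  filter_upwards [(star g).coeFn_toLp (p := 2) (𝕜 := ℂ) μ] with x h1
  rw [h1]
  simp

theorem convL2_integral (u : C(G, ℂ)) (f : Lp ℂ 2 μ) (g : C(X, ℂ)) :
    ∫ x, convL2 ν μ u f x * g x ∂μ = ∫ x, f x * convT ν u g x ∂μ := by
  have e : ∀ h : C(X, ℂ), integralMul μ g (ContinuousMap.toLp 2 μ ℂ h) = ∫ x, h x * g x ∂μ := by
    intro h
    rw [integralMul_apply]
    refine integral_congr_ae ?_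
    filter_upwards [h.coeFn_toLp (p := 2) (𝕜 := ℂ) μ] with x h1
    rw [h1]
  rw [← e, ← integralMul_apply]
  -- Both sides are continuous in `f`, so it suffices to treat continuous functions, which are dense
  -- in L².
  refine congrFun ((ContinuousMap.toLp_denseRange ℂ μ ℂ (p := 2) (by simp)).equalizer
    (g := (integralMul μ g).comp ((ContinuousMap.toLp 2 μ ℂ).comp (convL2 ν μ u)))
    (h := integralMul μ (convT ν u g)) (ContinuousLinearMap.continuous _)
    (ContinuousLinearMap.continuous _) (funext fun φ => ?_)) f
  have h1 := clm_conv ν ((integralMul μ g).comp (ContinuousMap.toLp 2 μ ℂ)) u φ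
  have h2 := convDual_toLp ν μ u (ContinuousMap.toLp ∞ μ ℂ φ) g
  simp only [Function.comp_apply, ContinuousLinearMap.comp_apply, convL2_toLp] at h1 ⊢
  rw [h1, integralMul_apply]
  rw [convDual_apply] at h2
  trans ∫ x, (ContinuousMap.toLp ∞ μ ℂ φ : Lp ℂ ∞ μ) x * convT ν u g x ∂μ
  · rw [← h2]
    congr 1 with α
    rw [smul_eq_mul, translateLp_toLp, pairing_apply, e]
    congr 1
    refine integral_congr_ae ?_
    filter_upwards [(translate α φ).coeFn_toLp (p := ∞) (𝕜 := ℂ) μ,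
      g.coeFn_toLp (p := 1) (𝕜 := ℂ) μ] with x h1 h2
    rw [h1, h2]
  · refine integral_congr_ae ?_
    filter_upwards [φ.coeFn_toLp (p := ∞) (𝕜 := ℂ) μ,
      φ.coeFn_toLp (p := 2) (𝕜 := ℂ) μ] with x h1 h2
    rw [h1, h2]

/-- This identifies the smoothing of `f` with the weak* integral of its translates. Both sides are
bounded functionals of `g`, and for continuous `g` both equal the integral of `f` against `convT`.
-/
theorem pairing_convL2 (u : C(G, ℂ)) (f : Lp ℂ ∞ μ) (g : Lp ℂ 1 μ) :
    pairing μ (ContinuousMap.toLp ∞ μ ℂ (convL2 ν μ u (linftyToL2 μ f))) g =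
      ∫ α : G, u α * pairing μ (translateLp μ ∞ α f) g ∂ν := by
  rw [← convDual_apply]
  refine congrFun ((ContinuousMap.toLp_denseRange ℂ μ ℂ (p := 1) (by simp)).equalizer
    (g := pairingL μ (ContinuousMap.toLp ∞ μ ℂ (convL2 ν μ u (linftyToL2 μ f))))
    (h := convDual ν μ u f) (ContinuousLinearMap.continuous _)
    (ContinuousLinearMap.continuous _) (funext fun g => ?_)) g
  rw [Function.comp_apply, Function.comp_apply, convDual_toLp]
  refine (pairing_apply μ _ _).trans ?_
  trans ∫ x, linftyToL2 μ f x * convT ν u g x ∂μ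
  · rw [← convL2_integral]
    refine integral_congr_ae ?_
    filter_upwards [(convL2 ν μ u (linftyToL2 μ f)).coeFn_toLp (p := ∞) (𝕜 := ℂ) μ,
      g.coeFn_toLp (p := 1) (𝕜 := ℂ) μ] with x h1 h2
    rw [h1, h2]
  · refine integral_congr_ae ?_
    filter_upwards [coeFn_linftyToL2 μ f] with x h1
    rw [h1]

end Convolution

end GSpace

/-! ### Stabilizer averages and reproducing kernels -/

namespace GSpace

section Kernel

variable {G X : Type*} [Group G] [TopologicalSpace G] [IsTopologicalGroup G] [CompactSpace G]
  [TopologicalSpace X] [CompactSpace X] [T2Space X] [MulAction G X] [ContinuousSMul G X]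
  [MulAction.IsPretransitive G X] [MeasurableSpace G] [BorelSpace G]
  [MeasurableSpace X] [BorelSpace X]

theorem compactSpace_stabilizer (G : Type*) {X : Type*} [Group G] [TopologicalSpace G]
    [CompactSpace G] [TopologicalSpace X] [T2Space X] [MulAction G X] [ContinuousSMul G X] (x : X) :
    CompactSpace (MulAction.stabilizer G x) := by
  have h : IsClosed (MulAction.stabilizer G x : Set G) :=
    isClosed_eq (f := fun α : G => α • x) (g := fun _ => x) (by fun_prop) (by fun_prop)
  exact isCompact_iff_compactSpace.mp h.isCompact

/-- Averaging over the stabilizer of a point projects onto the functions fixed by it. -/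
theorem conv_one_mem_fixedByStabilizer (x : X) [CompactSpace (MulAction.stabilizer G x)]
    (κ : Measure (MulAction.stabilizer G x)) [κ.IsHaarMeasure] [IsProbabilityMeasure κ]
    (f : C(X, ℂ)) : conv κ 1 f ∈ fixedByStabilizer G x := by
  intro α hα
  have := Measure.isMulRightInvariant_of_compactSpace κ
  ext y
  change conv κ 1 f y = conv κ 1 f (α • y)
  rw [conv_apply, conv_apply]
  refine (integral_mul_right_eq_self (fun β : MulAction.stabilizer G x =>
    (1 : C(MulAction.stabilizer G x, ℂ)) β * f (β • y)) ⟨α, hα⟩).symm.trans ?_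
  simp only [ContinuousMap.one_apply, mul_smul]
  rfl

theorem conv_one_apply_self (x : X) [CompactSpace (MulAction.stabilizer G x)]
    (κ : Measure (MulAction.stabilizer G x)) [IsProbabilityMeasure κ] (f : C(X, ℂ)) :
    conv κ 1 f x = f x := by
  have h : ∀ β : MulAction.stabilizer G x, β • x = x := fun β => β.2
  rw [conv_apply]
  simp [h]

/-- The value at a point determines the stabilizer average of a function in a minimal space. -/
theorem exists_conv_one_eq_smul (x : X) [CompactSpace (MulAction.stabilizer G x)]
    (κ : Measure (MulAction.stabilizer G x)) [κ.IsHaarMeasure] [IsProbabilityMeasure κ]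
    {H : Submodule ℂ C(X, ℂ)} (hcl : IsClosed (H : Set C(X, ℂ))) (hinv : IsInvariant G H)
    (hdim : Module.finrank ℂ ↥(H ⊓ fixedByStabilizer G x) = 1) :
    ∃ h ∈ H ⊓ fixedByStabilizer G x, h x = 1 ∧ ∀ f ∈ H, conv κ 1 f = f x • h := by
  have hmem : ∀ f ∈ H, conv κ 1 f ∈ H ⊓ fixedByStabilizer G x := fun f hf =>
    ⟨conv_mem κ 1 hcl (fun β g hg => hinv β g hg) hf, conv_one_mem_fixedByStabilizer x κ f⟩
  obtain ⟨f, hf, hfx⟩ : ∃ f ∈ H, f x ≠ 0 := by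
    obtain ⟨⟨g, hg⟩, hg0, -⟩ := finrank_eq_one_iff'.mp hdim
    have hg0 : g ≠ 0 := fun h => hg0 (Subtype.ext h)
    obtain ⟨z, hz⟩ := DFunLike.ne_iff.mp hg0
    obtain ⟨α, rfl⟩ := MulAction.exists_smul_eq G x z
    exact ⟨translate α g, hinv α g hg.1, hz⟩
  have hx : ((f x)⁻¹ • conv κ 1 f) x = 1 := by
    rw [ContinuousMap.smul_apply, conv_one_apply_self, smul_eq_mul, inv_mul_cancel₀ hfx]
  set h := (f x)⁻¹ • conv κ 1 f with hh
  have hhm : h ∈ H ⊓ fixedByStabilizer G x := Submodule.smul_mem _ _ (hmem f hf)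
  refine ⟨h, hhm, hx, fun g hg => ?_⟩
  have hne : (⟨h, hhm⟩ : ↥(H ⊓ fixedByStabilizer G x)) ≠ 0 := fun h0 => by
    have h0 : h = 0 := congrArg Subtype.val h0
    rw [h0] at hx
    simp at hx
  obtain ⟨c, hc⟩ := (finrank_eq_one_iff_of_nonzero' _ hne).mp hdim ⟨_, hmem g hg⟩
  have hc : c • h = conv κ 1 g := congrArg Subtype.val hc
  -- Averaging preserves the value at `x`, which identifies the coefficient `c` as `g x`.
  rw [← hc, ← conv_one_apply_self x κ g, ← hc, ContinuousMap.smul_apply, hx, smul_eq_mul, mul_one]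

variable (μ : Measure X) [IsProbabilityMeasure μ] [μ.Regular] [SMulInvariantMeasure G X μ]

/-- The functional `f ↦ ∫ f ḡ dμ` on continuous functions. -/
noncomputable def innerL (g : C(X, ℂ)) : C(X, ℂ) →L[ℂ] ℂ :=
  (innerSL ℂ (ContinuousMap.toLp 2 μ ℂ g)).comp (ContinuousMap.toLp 2 μ ℂ)

theorem innerL_apply (g f : C(X, ℂ)) :
    innerL μ g f = ∫ x, f x * starRingEnd ℂ (g x) ∂μ :=
  ContinuousMap.inner_toLp μ g f

theorem innerL_translate (g f : C(X, ℂ)) (α : G) :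
    innerL μ g (translate α f) = innerL μ (translate α⁻¹ g) f := by
  rw [innerL_apply, innerL_apply, ← (measurePreserving_smul α μ).integral_comp
    (Homeomorph.smul α).measurableEmbedding fun x => f x * starRingEnd ℂ (translate α⁻¹ g x)]
  simp [translate]

theorem innerL_conj (g f : C(X, ℂ)) : starRingEnd ℂ (innerL μ g f) = innerL μ f g :=
  inner_conj_symm (𝕜 := ℂ) (ContinuousMap.toLp 2 μ ℂ f) (ContinuousMap.toLp 2 μ ℂ g)

/-- Finitely many translates of a nonempty open set cover X. Consequently C(X) embeds injectively in
L²(μ). -/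
theorem isOpenPosMeasure (G : Type*) {X : Type*} [Group G] [TopologicalSpace G]
    [TopologicalSpace X] [CompactSpace X] [MulAction G X] [ContinuousSMul G X]
    [MulAction.IsPretransitive G X] [MeasurableSpace X] [BorelSpace X] (μ : Measure X)
    [IsProbabilityMeasure μ] [SMulInvariantMeasure G X μ] : μ.IsOpenPosMeasure :=
  ⟨fun _ hU hne => (measure_isOpen_pos_of_smulInvariant_of_compact_ne_zero G isCompact_univ
    (by simp) hU hne).ne'⟩

/-- A minimal space whose functions fixed by a stabilizer form a line has a reproducing kernel,
which spans the stabilizer averages. -/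
theorem exists_kernel (x : X) [CompactSpace (MulAction.stabilizer G x)]
    (κ : Measure (MulAction.stabilizer G x)) [κ.IsHaarMeasure] [IsProbabilityMeasure κ]
    {H : Submodule ℂ C(X, ℂ)} (hcl : IsClosed (H : Set C(X, ℂ))) (hinv : IsInvariant G H)
    (hdim : Module.finrank ℂ ↥(H ⊓ fixedByStabilizer G x) = 1) :
    ∃ k ∈ H, k x ≠ 0 ∧ (∀ f ∈ H, innerL μ k f = f x) ∧
      ∀ f ∈ H, k x • conv κ 1 f = f x • k := by
  obtain ⟨h, hh, hx, hav⟩ := exists_conv_one_eq_smul x κ hcl hinv hdim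
  have := isOpenPosMeasure G μ
  set c := innerL μ h h with hc
  have hc0 : c ≠ 0 := by
    have hne : ContinuousMap.toLp 2 μ ℂ h ≠ 0 := fun h0 => by
      rw [← map_zero (ContinuousMap.toLp 2 μ ℂ), ContinuousMap.toLp_inj] at h0
      rw [h0] at hx
      simp at hx
    exact inner_self_ne_zero.mpr hne
  have hcc : starRingEnd ℂ c = c := innerL_conj μ h h
  have hrep : ∀ f ∈ H, innerL μ h f = f x * c := by
    -- Since `h` is fixed by the stabilizer, pairing with `h` does not see the averaging of `f`, and
    -- that average is `f x • h`.
    intro f hf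
    have h1 := clm_conv κ (innerL μ h) 1 f
    rw [hav f hf, map_smul, smul_eq_mul] at h1
    rw [h1]
    have h2 : ∀ β : MulAction.stabilizer G x, innerL μ h (translate β f) = innerL μ h f := by
      intro β
      have h3 := hh.2 (β : G)⁻¹ (inv_mem β.2)
      exact (innerL_translate μ h f (β : G)).trans (by rw [← h3])
    simp [h2]
  refine ⟨c⁻¹ • h, H.smul_mem _ hh.1, by simp [hx, hc0], fun f hf => ?_, fun f hf => ?_⟩
  · rw [← innerL_conj, map_smul, smul_eq_mul, map_mul, innerL_conj, hrep f hf, map_inv₀, hcc]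
    field_simp
  · rw [hav f hf, ContinuousMap.smul_apply, hx, smul_eq_mul, mul_one, smul_comm]

variable (ν : Measure G) [IsProbabilityMeasure ν] [ν.IsHaarMeasure]

/-- The function `α ↦ v(α⁻¹ x)` on the group. -/
noncomputable def orbitInv (G : Type*) {X : Type*} [Group G] [TopologicalSpace G] [IsTopologicalGroup G]
    [TopologicalSpace X] [MulAction G X] [ContinuousSMul G X] (v : C(X, ℂ)) (x : X) : C(G, ℂ) :=
  ⟨fun α => v (α⁻¹ • x), by fun_prop⟩

/-- Convolving a reproducing kernel with `α ↦ v(α⁻¹ x)` projects `v` onto the space. -/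
theorem conv_orbitInv_kernel {H : Submodule ℂ C(X, ℂ)} (hinv : IsInvariant G H)
    {k : X → C(X, ℂ)} (hk : ∀ x, k x ∈ H) (hrep : ∀ x, ∀ f ∈ H, innerL μ (k x) f = f x)
    (v : C(X, ℂ)) (x y : X) : conv ν (orbitInv G v x) (k x) y = innerL μ (k y) v := by
  have := Measure.isInvInvariant_of_compactSpace ν
  -- Hermitian symmetry of the kernel, combined with its behaviour under translation.
  have h : ∀ α : G, k x (α • y) = starRingEnd ℂ (k y (α⁻¹ • x)) := by
    intro α
    have h1 : innerL μ (k y) (translate α (k x)) = k x (α • y) := hrep y _ (hinv α _ (hk x))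
    have h2 : innerL μ (k x) (translate α⁻¹ (k y)) = k y (α⁻¹ • x) :=
      hrep x _ (hinv α⁻¹ _ (hk y))
    rw [← h1, ← h2, innerL_conj, innerL_translate]
  rw [conv_apply, innerL_apply]
  refine Eq.trans ?_
    (integral_orbit μ ν ⟨fun z => v z * starRingEnd ℂ (k y z), by fun_prop⟩ x)
  rw [← integral_inv_eq_self _ ν]
  congr 1 with α
  simp [h, orbitInv]

/-- The weight `α ↦ v(α⁻¹ x)` is unchanged by left multiplication by the stabilizer of `x`. -/
theorem conv_orbitInv_translate (v f : C(X, ℂ)) (x : X) {β : G} (hβ : β • x = x) :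
    conv ν (orbitInv G v x) (translate β f) = conv ν (orbitInv G v x) f := by
  ext y
  rw [conv_apply, conv_apply]
  refine Eq.trans ?_ (integral_mul_left_eq_self
    (fun α : G => orbitInv G v x α * f (α • y)) β)
  congr 1 with α
  simp only [orbitInv, translate, ContinuousMap.coe_mk, ContinuousMap.comp_apply, mul_inv_rev,
    mul_smul]
  rw [inv_smul_eq_iff.mpr hβ.symm]

include μ in
-- By the previous lemma `f` may be replaced by its stabilizer average, which `hav` makes
-- proportional to `k`.
theorem conv_orbitInv_eq (x : X) {H : Submodule ℂ C(X, ℂ)} [CompactSpace (MulAction.stabilizer G x)]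
    (κ : Measure (MulAction.stabilizer G x)) [κ.IsHaarMeasure] [IsProbabilityMeasure κ]
    {k : C(X, ℂ)} (hav : ∀ f ∈ H, k x • conv κ 1 f = f x • k) (v : C(X, ℂ)) {f : C(X, ℂ)}
    (hf : f ∈ H) :
    k x • conv ν (orbitInv G v x) f = f x • conv ν (orbitInv G v x) k := by
  -- Factoring through L² presents convolution as a bounded operator, which may pass under the
  -- integral over the stabilizer.
  let L : C(X, ℂ) →L[ℂ] C(X, ℂ) :=
    (convL2 ν μ (orbitInv G v x)).comp (ContinuousMap.toLp 2 μ ℂ)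
  have hL : ∀ g, L g = conv ν (orbitInv G v x) g := convL2_toLp ν μ _
  have h1 := clm_conv κ L 1 f
  have h2 : ∀ β : MulAction.stabilizer G x, L (translate β f) = L f := fun β => by
    rw [hL, hL]
    exact conv_orbitInv_translate ν v f x (β := β) β.2
  have h3 : L (conv κ 1 f) = L f := by simpa [h2] using h1
  rw [← hL, ← hL, ← h3, ← map_smul, hav f hf, map_smul]

end Kernel

/-! ### Expansion along a G-collection and invariant subspaces -/

section Collection

variable {G X I : Type*} [Group G] [TopologicalSpace G] [IsTopologicalGroup G] [CompactSpace G]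
  [TopologicalSpace X] [CompactSpace X] [T2Space X] [MulAction G X] [ContinuousSMul G X]
  [MulAction.IsPretransitive G X] [MeasurableSpace G] [BorelSpace G]
  [MeasurableSpace X] [BorelSpace X]
  (μ : Measure X) [IsProbabilityMeasure μ] [μ.Regular] [SMulInvariantMeasure G X μ]
  (ν : Measure G) [IsProbabilityMeasure ν] [ν.IsHaarMeasure]
  {H : I → Submodule ℂ C(X, ℂ)}

/-- The Hilbert-sum coordinates are the projections: tested against a vector of `H i`, the expansion
keeps only its `i`-th term. -/
theorem IsGCollection.hasSum_proj (hH : IsGCollection G μ H) (f : Lp ℂ 2 μ) :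
    HasSum (fun i => (hH.proj i f : Lp ℂ 2 μ)) f := by
  have hs := hH.isHilbertSum.hasSum_linearIsometryEquiv_symm
    (hH.isHilbertSum.linearIsometryEquiv f)
  rw [LinearIsometryEquiv.symm_apply_apply] at hs
  convert hs using 2 with i
  have := hasOrthogonalProjection_of_isHilbertSum hH.isHilbertSum i
  change (inL2 μ (H i)).starProjection f = _
  refine Submodule.eq_starProjection_of_mem_of_inner_eq_zero (K := inL2 μ (H i)) (u := f)
    (v := (inL2 μ (H i)).subtypeₗᵢ (hH.isHilbertSum.linearIsometryEquiv f i)) (SetLike.coe_mem _)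
    fun w hw => ?_
  have h1 := hs.mapL (innerSL ℂ w)
  have h2 : HasSum (fun j => innerSL ℂ w ((inL2 μ (H j)).subtypeₗᵢ
      (hH.isHilbertSum.linearIsometryEquiv f j))) (innerSL ℂ w ((inL2 μ (H i)).subtypeₗᵢ
      (hH.isHilbertSum.linearIsometryEquiv f i))) :=
    hasSum_single i fun j hj => hH.isHilbertSum.OrthogonalFamily (Ne.symm hj) ⟨w, hw⟩
      (hH.isHilbertSum.linearIsometryEquiv f j)
  have h3 := h1.unique h2
  rw [← inner_conj_symm, inner_sub_right]
  exact (congrArg _ (sub_eq_zero.mpr h3)).trans (map_zero _)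

/-- Convolution maps a square integrable function to the uniformly convergent sum of the
convolutions of its components. -/
theorem IsGCollection.hasSum_convL2 (hH : IsGCollection G μ H) (f : Lp ℂ 2 μ) (u : C(G, ℂ))
    {p : I → C(X, ℂ)} (hp : ∀ i, ContinuousMap.toLp 2 μ ℂ (p i) = hH.proj i f) :
    HasSum (fun i => conv ν u (p i)) (convL2 ν μ u f) := by
  have h := (hH.hasSum_proj μ f).mapL (convL2 ν μ u)
  simpa only [← hp, convL2_toLp] using h

theorem IsGCollection.exists_components (hH : IsGCollection G μ H) (f : Lp ℂ 2 μ) :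
    ∃ p : I → C(X, ℂ), ∀ i, p i ∈ H i ∧ ContinuousMap.toLp 2 μ ℂ (p i) = hH.proj i f :=
  Classical.skolem.mp fun i => Submodule.mem_map.mp (hH.proj i f).2

/-- Any `g` that annihilates `Y` annihilates all translates of `f`, hence their weak* integral;
closedness of `Y` then suffices. -/
theorem convL2_mem {Y : Submodule ℂ (Lp ℂ ∞ μ)}
    (hYclosed : IsClosed[weakStarTopology μ] (Y : Set (Lp ℂ ∞ μ)))
    (hYinv : IsInvariantLinfty G Y) (u : C(G, ℂ)) {f : Lp ℂ ∞ μ} (hf : f ∈ Y) :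
    ContinuousMap.toLp ∞ μ ℂ (convL2 ν μ u (linftyToL2 μ f)) ∈ Y := by
  by_contra hn
  obtain ⟨g, hg, hne⟩ :=
    (pairing μ).exists_separating_of_isClosed_weakBilin Y hYclosed hn
  refine hne ?_
  rw [pairing_convL2]
  simp [hg _ (hYinv _ f hf)]

include ν in
/-- A closed invariant subspace contains each member of the collection onto which it has a nonzero
projection. -/
theorem IsGCollection.inLinfty_le (hH : IsGCollection G μ H) {Y : Submodule ℂ (Lp ℂ ∞ μ)}
    (hYclosed : IsClosed[weakStarTopology μ] (Y : Set (Lp ℂ ∞ μ)))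
    (hYinv : IsInvariantLinfty G Y) {i : I} {f : Lp ℂ ∞ μ} (hf : f ∈ Y)
    (hfi : hH.proj i (linftyToL2 μ f) ≠ 0) : H i ≤ Y.comap (ContinuousMap.toLp ∞ μ ℂ).toLinearMap := by
  obtain ⟨p, hp⟩ := hH.exists_components μ (linftyToL2 μ f)
  obtain ⟨x, hx⟩ : ∃ x, p i x ≠ 0 := by
    by_contra! h
    have h0 : p i = 0 := ContinuousMap.ext h
    refine hfi (Subtype.ext ?_)
    rw [← (hp i).2, h0, map_zero]
    rfl
  have hker : ∀ (j : I) (y : X), ∃ k ∈ H j, k y ≠ 0 ∧ (∀ g ∈ H j, innerL μ k g = g y) ∧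
      ∀ (v g : C(X, ℂ)), g ∈ H j →
        k y • conv ν (orbitInv G v y) g = g y • conv ν (orbitInv G v y) k := by
    intro j y
    have := compactSpace_stabilizer G y
    obtain ⟨κ, hκ, hκ'⟩ :=
      Measure.exists_isHaarMeasure_isProbabilityMeasure (MulAction.stabilizer G y)
    obtain ⟨k, hk, hky, hrep, hav⟩ := exists_kernel μ y κ (hH.isClosed j) (hH.isMinimal j).1
      (hH.finrank_inf_fixedByStabilizer y j)
    exact ⟨k, hk, hky, hrep, fun v g hg => conv_orbitInv_eq μ ν y κ hav v hg⟩
  choose k hk hk0 hrep hconv using hker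
  set v := k i x
  have hproj : ∀ j y, conv ν (orbitInv G v x) (k j x) y = innerL μ (k j y) v := fun j y =>
    conv_orbitInv_kernel μ ν (hH.isMinimal j).1 (hk j) (hrep j) v x y
  have hi : conv ν (orbitInv G v x) (k i x) = v := by
    ext y
    rw [hproj, hrep i y v (hk i x)]
  -- For `j ≠ i` the convolution of the kernel of `H j` is the projection of `v ∈ H i` onto `H j`,
  -- which is zero.
  have hj : ∀ j, j ≠ i → conv ν (orbitInv G v x) (p j) = 0 := by
    intro j hji
    have h0 : conv ν (orbitInv G v x) (k j x) = 0 := by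
      ext y
      rw [hproj, innerL_apply]
      exact hH.orthogonal i j hji.symm _ (hk i x) _ (hk j y)
    have h1 := hconv j x v (p j) (hp j).1
    rw [h0, smul_zero] at h1
    exact (smul_eq_zero.mp h1).resolve_left (hk0 j x)
  have hsum : convL2 ν μ (orbitInv G v x) (linftyToL2 μ f) = conv ν (orbitInv G v x) (p i) :=
    (hH.hasSum_convL2 μ ν _ _ fun j => (hp j).2).unique (hasSum_single i hj)
  have hmem := convL2_mem μ ν hYclosed hYinv (orbitInv G v x) hf
  have hvY : v ∈ Y.comap (ContinuousMap.toLp ∞ μ ℂ).toLinearMap := by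
    have h1 := hconv i x v (p i) (hp i).1
    rw [hi, ← hsum] at h1
    have h2 : v = (p i x)⁻¹ • k i x x • convL2 ν μ (orbitInv G v x) (linftyToL2 μ f) := by
      rw [h1, inv_smul_smul₀ hx]
    rw [h2]
    exact Submodule.smul_mem _ _ (Submodule.smul_mem _ _ hmem)
  -- The intersection is invariant and contains `v ≠ 0`, so minimality makes it all of `H i`.
  have hinv : IsInvariant G (H i ⊓ Y.comap (ContinuousMap.toLp ∞ μ ℂ).toLinearMap) := by
    refine fun α g hg => ⟨(hH.isMinimal i).1 α g hg.1, ?_⟩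
    have h1 := hYinv α _ hg.2
    have h2 := translateLp_toLp μ ∞ α g
    change ContinuousMap.toLp ∞ μ ℂ (translate α g) ∈ Y
    rw [← h2]
    exact h1
  rcases (hH.isMinimal i).2 _ inf_le_left hinv with h | h
  · have hv : v ∈ (⊥ : Submodule ℂ C(X, ℂ)) := h ▸ ⟨hk i x, hvY⟩
    exact absurd (DFunLike.congr_fun ((Submodule.mem_bot ℂ).mp hv) x) (hk0 i x)
  · exact inf_eq_left.mp h

include ν in
/-- A functional that annihilates the members of the collection onto which an invariant subspace
has a nonzero projection annihilates the subspace. -/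
theorem IsGCollection.pairing_eq_zero (hH : IsGCollection G μ H) {f : Lp ℂ ∞ μ} {g : Lp ℂ 1 μ}
    (hg : ∀ i, hH.proj i (linftyToL2 μ f) ≠ 0 →
      ∀ h ∈ H i, pairing μ (ContinuousMap.toLp ∞ μ ℂ h) g = 0) : pairing μ f g = 0 := by
  obtain ⟨p, hp⟩ := hH.exists_components μ (linftyToL2 μ f)
  have := isOpenPosMeasure G μ
  have hconv : ∀ u : C(G, ℂ), ∫ α : G, u α * pairing μ (translateLp μ ∞ α f) g ∂ν = 0 := by
    intro u
    rw [← pairing_convL2]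
    have hs := (hH.hasSum_convL2 μ ν (linftyToL2 μ f) u fun j => (hp j).2).mapL
      (((pairingL μ).flip g).comp (ContinuousMap.toLp ∞ μ ℂ))
    refine hs.unique ?_
    convert hasSum_zero using 2 with j
    by_cases hj : hH.proj j (linftyToL2 μ f) = 0
    · have h0 : p j = 0 := by
        have h1 := (hp j).2
        rw [hj, ZeroMemClass.coe_zero, ← map_zero (ContinuousMap.toLp 2 μ ℂ),
          ContinuousMap.toLp_inj] at h1
        exact h1
      have h2 : conv ν u (p j) = 0 := h0 ▸ map_zero (convₗ ν u)
      rw [h2, map_zero]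
    · exact hg j hj _ (conv_mem ν u (hH.isClosed j) (hH.isMinimal j).1 (hp j).1)
  let F : C(G, ℂ) := ⟨_, continuous_pairing_translateLp μ f g⟩
  have hF : ∫ α : G, (‖F α‖ ^ 2 : ℝ) ∂ν = 0 := by
    -- The weight is the conjugate of `F` itself, so the vanishing integral is the squared L² norm
    -- of `F`.
    have h1 := hconv (star F)
    have h2 : ∫ α : G, ((‖F α‖ ^ 2 : ℝ) : ℂ) ∂ν = 0 := by
      rw [← h1]
      congr 1 with α
      push_cast
      exact (Complex.conj_mul' (F α)).symm
    rw [integral_complex_ofReal] at h2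
    exact_mod_cast h2
  have hF1 : F 1 = 0 := by
    by_contra hne
    have hpos := Continuous.integral_pos_of_hasCompactSupport_nonneg_nonzero (μ := ν)
      (f := fun α => ‖F α‖ ^ 2) (x := 1) (by fun_prop) (.of_compactSpace _)
      (fun α => by positivity) (by positivity)
    exact hpos.ne' hF
  have h1 : translateLp μ ∞ (1 : G) f = f := by
    apply Lp.ext
    filter_upwards [Lp.coeFn_compMeasurePreserving f (measurePreserving_smul (1 : G) μ)] with x hx
    rw [hx]
    simp
  rw [← h1]
  exact hF1

end Collection

end GSpace

/-! ### The theorem -/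

theorem mainTheorem1 {G X I : Type*}
    [Group G] [TopologicalSpace G] [IsTopologicalGroup G] [CompactSpace G]
    [TopologicalSpace X] [CompactSpace X] [T2Space X]
    [MulAction G X] [ContinuousSMul G X] [MulAction.IsPretransitive G X]
    [MeasurableSpace X] [BorelSpace X]
    (μ : MeasureTheory.Measure X) [MeasureTheory.IsProbabilityMeasure μ] [μ.Regular]
    [MeasureTheory.SMulInvariantMeasure G X μ]
    (H : I → Submodule ℂ C(X, ℂ)) (hH : GSpace.IsGCollection G μ H)
    (Y : Submodule ℂ (MeasureTheory.Lp ℂ ∞ μ))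
    (hYclosed : IsClosed[GSpace.weakStarTopology μ] (Y : Set (MeasureTheory.Lp ℂ ∞ μ)))
    (hYinv : GSpace.IsInvariantLinfty G Y) :
    ∃ Ω : Set I,
      (Y : Set (MeasureTheory.Lp ℂ ∞ μ)) =
        GSpace.weakStarClosure μ (GSpace.inLinfty μ (GSpace.sumOver H Ω) : Set _) ∧
      Ω = {i : I | Y.map ((hH.proj i).toLinearMap ∘ₗ GSpace.linftyToL2 μ) ≠ ⊥} := by
  borelize G
  obtain ⟨ν, hν, hν'⟩ := Measure.exists_isHaarMeasure_isProbabilityMeasure G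
  refine ⟨_, Set.Subset.antisymm (fun f hf => ?_) ?_, rfl⟩
  · by_contra hn
    obtain ⟨g, hg, hne⟩ := (GSpace.pairing μ).exists_separating_of_notMem_closure_weakBilin _ hn
    refine hne (hH.pairing_eq_zero μ ν fun i hi h hh => hg _ ?_)
    refine Submodule.mem_map_of_mem (Submodule.mem_iSup_of_mem i (Submodule.mem_iSup_of_mem ?_ hh))
    exact fun h0 => hi ((Submodule.mem_bot ℂ).mp (h0 ▸ Submodule.mem_map_of_mem hf))
  · refine @closure_minimal _ (GSpace.weakStarTopology μ) _ _ ?_ hYclosed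
    refine SetLike.coe_subset_coe.mpr (Submodule.map_le_iff_le_comap.mpr
      (iSup₂_le fun i hi => ?_))
    obtain ⟨_, ⟨f, hf, rfl⟩, hfi⟩ := (Submodule.ne_bot_iff _).mp hi
    exact hH.inLinfty_le μ ν hYclosed hYinv hf hfi
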